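/- **Conventions.** A *frame* is a poset; it is *rooted* if it has a least element. A *model* on $n$ variables is a poset $M$ with an order-preserving *colouring* $c:M\to 2^n$; $p_i$ holds at $x$ iff $c(x)_i=1$, satisfaction of formulas of IPC is Kripke satisfaction, and $M$ *refutes* a formula ($M\not\models\varphi$) if some point of $M$ does not satisfy it. A *p-morphism* of models is an order-preserving, colour-preserving map $f:M\to M'$ such that $f(x)\le y$ implies $y=f(x')$ for some $x'\ge x$; $M'$ is a *p-morphic image* of $M$ if there is a surjective p-morphism $M\to M'$. A *generated submodel* is an up-set with the restricted order and colouring. A point $x$ of $M$ is *separated* if for some $i$ the variable $p_i$ fails at $x$ and holds at all $y>x$; $M^s$ is the submodel of all separated points (with the restricted order and colouring). The *universal model* $U(n)$ consists of the prime filters $x$ of the Lindenbaum algebra of IPC on $p_1,\dots,p_n$, ordered by inclusion, that have only finitely many prime filters above them; $p_i$ holds at $x$ iff $p_i\in x$. $U(n)_{\wedge,\to}$ is the generated submodel of $U(n)$ that is the image of the unique p-morphism $U(n)^s\to U(n)$. A *descriptive model* is a model $N$ together with a Heyting subalgebra $A$ of the algebra of up-sets of $N$ (the admissible sets) such that the set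 where $p_i$ holds lies in $A$ for each $i$, and such that $x\mapsto\{U\in A : x\in U\}$ is an order isomorphism from $N$ onto the prime filters of $A$ ordered by inclusion. A *$(\wedge,\to)$-formula* is one built from variables by $\wedge$ and $\to$ only. Prime filters are proper. **Theorem.** Let $F$ be a finite rooted frame. (i) If $F=\{x_1,\dots,x_n\}$ with $x_1,\dots,x_n$ distinct and $c:F\to 2^n$ is given by $c(x)_j=0$ iff $x\le x_j$, then $(F,c)$ is a model isomorphic to a generated submodel of $U(n)_{\wedge,\to}$. (ii) Let $n$ be a natural number and let $c:F\to 2^n$ be any colouring for which $(F,c)$ is isomorphic to a generated submodel of $U(n)_{\wedge,\to}$. Then there is a $(\wedge,\to)$-formula $\beta(F)$ in $p_1,\dots,p_n$ (the *subframe formula* of $F$) such that for every descriptive model $N$ on $n$ variables $$N\not\models\beta(F)\iff (F,c)\text{ is a p-morphic image of a generated submodel of }N^s .$$ -/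

import Mathlib

universe u v

namespace MeetImp

/-! ### Formulas and derivability in IPC -/

/-- Propositional formulas over the variables `p_0, …, p_{n-1}`. -/
inductive Formula (n : ℕ) : Type
  | var : Fin n → Formula n
  | bot : Formula n
  | and : Formula n → Formula n → Formula n
  | or : Formula n → Formula n → Formula n
  | imp : Formula n → Formula n → Formula n

/-- The formulas that are built from variables with `∧` and `→` only. -/
def Formula.IsMeetImp {n : ℕ} : Formula n → Prop
  | .var _ => True
  | .bot => False
  | .and a b => a.IsMeetImp ∧ b.IsMeetImp
  | .or _ _ => False
  | .imp a b => a.IsMeetImp ∧ b.IsMeetImp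

/-- Natural deduction for intuitionistic propositional logic, with sets of assumptions. -/
inductive Proves {n : ℕ} : Set (Formula n) → Formula n → Prop
  | ax {Γ : Set (Formula n)} {a : Formula n} : a ∈ Γ → Proves Γ a
  | botE {Γ : Set (Formula n)} {a : Formula n} : Proves Γ .bot → Proves Γ a
  | andI {Γ : Set (Formula n)} {a b : Formula n} :
      Proves Γ a → Proves Γ b → Proves Γ (.and a b)
  | andE₁ {Γ : Set (Formula n)} {a b : Formula n} : Proves Γ (.and a b) → Proves Γ a
  | andE₂ {Γ : Set (Formula n)} {a b : Formula n} : Proves Γ (.and a b) → Proves Γ b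
  | orI₁ {Γ : Set (Formula n)} {a b : Formula n} : Proves Γ a → Proves Γ (.or a b)
  | orI₂ {Γ : Set (Formula n)} {a b : Formula n} : Proves Γ b → Proves Γ (.or a b)
  | orE {Γ : Set (Formula n)} {a b c : Formula n} :
      Proves Γ (.or a b) → Proves (insert a Γ) c → Proves (insert b Γ) c → Proves Γ c
  | impI {Γ : Set (Formula n)} {a b : Formula n} :
      Proves (insert a Γ) b → Proves Γ (.imp a b)
  | impE {Γ : Set (Formula n)} {a b : Formula n} :
      Proves Γ (.imp a b) → Proves Γ a → Proves Γ b

/-! ### Models, satisfaction, p-morphisms, separated points -/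

/-- A colouring of a poset: an order-preserving map to `2^n`. (`Prop` is the two-element chain
`False ≤ True`, and `Fin n → Prop` carries the pointwise order.) A model on `n` variables is a
poset together with a colouring. -/
abbrev Colouring (n : ℕ) (W : Type u) [PartialOrder W] : Type u := W →o (Fin n → Prop)

/-- Kripke satisfaction at a point of a model. -/
def Sat {n : ℕ} {W : Type u} [PartialOrder W] (c : Colouring n W) : W → Formula n → Prop
  | x, .var i => c x i
  | _, .bot => False
  | x, .and a b => Sat c x a ∧ Sat c x b
  | x, .or a b => Sat c x a ∨ Sat c x b
  | x, .imp a b => ∀ y, x ≤ y → Sat c y a → Sat c y b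

/-- A model refutes a formula if some point does not satisfy it. -/
def Refutes {n : ℕ} {W : Type u} [PartialOrder W] (c : Colouring n W) (a : Formula n) : Prop :=
  ∃ x, ¬ Sat c x a

/-- The submodel on a set of points, with the restricted order and colouring. -/
def Colouring.restrict {n : ℕ} {W : Type u} [PartialOrder W] (c : Colouring n W) (S : Set W) :
    Colouring n S :=
  c.comp (OrderHom.Subtype.val (· ∈ S))

/-- p-morphisms of models: order-preserving, with the back condition, preserving colours. -/
structure IsPMorphism {n : ℕ} {W : Type u} {V : Type v} [PartialOrder W] [PartialOrder V]
    (c : Colouring n W) (d : Colouring n V) (f : W → V) : Prop where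
  monotone : Monotone f
  back : ∀ (x : W) (y : V), f x ≤ y → ∃ x', x ≤ x' ∧ f x' = y
  colour : ∀ x, d (f x) = c x

/-- The model `(V, d)` is a p-morphic image of the model `(W, c)`. -/
def IsPMorphicImage {n : ℕ} {V : Type v} {W : Type u} [PartialOrder V] [PartialOrder W]
    (d : Colouring n V) (c : Colouring n W) : Prop :=
  ∃ f : W → V, IsPMorphism c d f ∧ Function.Surjective f

/-- `x` is a border point of the up-set where the variable `p_i` holds. -/
def IsBorderPoint {n : ℕ} {W : Type u} [PartialOrder W] (c : Colouring n W) (i : Fin n)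
    (x : W) : Prop :=
  ¬ c x i ∧ ∀ y, x < y → c y i

/-- The set of separated points of a model. -/
def sep {n : ℕ} {W : Type u} [PartialOrder W] (c : Colouring n W) : Set W :=
  {x | ∃ i, IsBorderPoint c i x}

/-- The submodel `M^s` of separated points. -/
def Colouring.sepModel {n : ℕ} {W : Type u} [PartialOrder W] (c : Colouring n W) :
    Colouring n (sep c) :=
  c.restrict (sep c)

/-! ### The canonical model and the universal model -/

/-- The points of the canonical frame: the prime filters of the Lindenbaum algebra of IPC, that
is, the consistent deductively closed sets of formulas with the disjunction property. -/
@[ext]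
structure CanonPoint (n : ℕ) : Type where
  carrier : Set (Formula n)
  closed : ∀ a, Proves carrier a → a ∈ carrier
  consistent : Formula.bot ∉ carrier
  prime : ∀ a b, Formula.or a b ∈ carrier → a ∈ carrier ∨ b ∈ carrier

instance (n : ℕ) : PartialOrder (CanonPoint n) :=
  PartialOrder.lift CanonPoint.carrier (fun _ _ h => CanonPoint.ext h)

/-- The universal frame: the image-finite part of the canonical frame. -/
abbrev Univ (n : ℕ) : Type := {x : CanonPoint n // (Set.Ici x).Finite}

/-- The colouring of the universal model `U(n)`: `p_i` holds at `x` iff `p_i` belongs to `x`. -/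
def univCol (n : ℕ) : Colouring n (Univ n) where
  toFun x i := Formula.var i ∈ x.1.carrier
  monotone' _ _ h _ hi := h hi

/-- `U(n)_{∧,→}`: the image of the (unique) p-morphism from `U(n)^s` to `U(n)`. -/
def univMeetImp (n : ℕ) : Set (Univ n) :=
  {w | ∃ f : sep (univCol n) → Univ n,
    IsPMorphism (univCol n).sepModel (univCol n) f ∧ w ∈ Set.range f}

/-- The model `(W, c)` is isomorphic to a generated submodel of `U(n)_{∧,→}`. -/
def SitsInUnivMeetImp {n : ℕ} {W : Type u} [PartialOrder W] (c : Colouring n W) : Prop :=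
  ∃ S : Set (univMeetImp n), IsUpperSet S ∧
    ∃ g : W ≃o S, ∀ x, ((univCol n).restrict (univMeetImp n)).restrict S (g x) = c x

/-- For an enumeration `x_0, …, x_{n-1}` of a poset, the colouring for which the `j`-th
coordinate of the colour of `x` is `0` iff `x ≤ x_j`. -/
def enumCol {n : ℕ} {F : Type u} [PartialOrder F] (e : Fin n ≃ F) : Colouring n F where
  toFun x j := ¬ x ≤ e j
  monotone' _ _ h _ hx hy := hx (h.trans hy)

/-! ### Descriptive models -/

/-- A general frame on a poset: a Heyting subalgebra of its algebra of up-sets. -/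
structure GeneralFrame (W : Type u) [PartialOrder W] : Type u where
  adm : Set (Set W)
  isUpperSet : ∀ U ∈ adm, IsUpperSet U
  empty_mem : ∅ ∈ adm
  univ_mem : Set.univ ∈ adm
  inter_mem : ∀ U ∈ adm, ∀ V ∈ adm, U ∩ V ∈ adm
  union_mem : ∀ U ∈ adm, ∀ V ∈ adm, U ∪ V ∈ adm
  imp_mem : ∀ U ∈ adm, ∀ V ∈ adm, {x | ∀ y, x ≤ y → y ∈ U → y ∈ V} ∈ adm

/-- Prime (proper) filters of the algebra of admissible sets. -/
structure GeneralFrame.IsPrimeFilter {W : Type u} [PartialOrder W] (A : GeneralFrame W)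
    (P : Set (Set W)) : Prop where
  subset_adm : P ⊆ A.adm
  univ_mem : Set.univ ∈ P
  empty_notMem : ∅ ∉ P
  inter_mem : ∀ U ∈ P, ∀ V ∈ P, U ∩ V ∈ P
  upward : ∀ U ∈ P, ∀ V ∈ A.adm, U ⊆ V → V ∈ P
  prime : ∀ U ∈ A.adm, ∀ V ∈ A.adm, U ∪ V ∈ P → U ∈ P ∨ V ∈ P

/-- A general frame is descriptive if its poset is the dual poset of its algebra: sending `x` to
the prime filter of the admissible sets that contain `x` is an order isomorphism onto the prime
filters of the algebra, ordered by inclusion. -/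
structure GeneralFrame.IsDescriptive {W : Type u} [PartialOrder W] (A : GeneralFrame W) :
    Prop where
  le_of_forall : ∀ x y : W, (∀ U ∈ A.adm, x ∈ U → y ∈ U) → x ≤ y
  exists_point : ∀ P, A.IsPrimeFilter P → ∃ x : W, P = {U | U ∈ A.adm ∧ x ∈ U}

/-- A colouring is admissible if every variable holds on an admissible set. -/
def GeneralFrame.IsAdmissible {n : ℕ} {W : Type u} [PartialOrder W] (A : GeneralFrame W)
    (c : Colouring n W) : Prop :=
  ∀ i, {x | c x i} ∈ A.adm

end MeetImp

namespace MeetImp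

/-! ### Satisfaction, theories and p-morphisms -/

section Models

variable {n : ℕ} {W : Type u} {V : Type v} [PartialOrder W] [PartialOrder V]
  {c : Colouring n W} {d : Colouring n V}

/-! A model of separated points is small: a strict step up makes a further variable true, so by
induction on the number of false variables only finitely many theories occur
(`finite_range_theory`). If finitely many theories occur, sending a point to its theory is a
p-morphism to `U(n)`, because every prime filter extending the theory of `x` is the theory of a
point above `x` (`exists_theory_eq_carrier`). Hence `U(n)_{∧,→}` is finite, consists of the points
with only separated points above them, and receives such a map from every `N^s`.

For (ii), the complement of a principal down-set of `U(n)_{∧,→}` is definable by a `(∧,→)`-formula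
(`exists_isMeetImp_sat_iff_not_le`); `β(F)` is that formula for the image `r` of the root. It fails
in `N^s` iff some theory lies below `r`, hence, by the back condition, iff `r` itself is a theory,
and this says that `F` is a p-morphic image of a generated submodel. Finally `N` and `N^s` refute
the same `(∧,→)`-formulas: in a descriptive model a refuted formula fails at a maximal point, and
such a point is separated.

For (i), each point is a border point of its own variable and colours reflect the order, so the
theory map is an embedding. -/

theorem Sat.mono {x y : W} (h : x ≤ y) : ∀ {a : Formula n}, Sat c x a → Sat c y a
  | .var i, hx => c.monotone h i hx
  | .bot, hx => hx
  | .and _ _, hx => ⟨hx.1.mono h, hx.2.mono h⟩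
  | .or _ _, hx => hx.imp (Sat.mono h) (Sat.mono h)
  | .imp _ _, hx => fun z hz => hx z (h.trans hz)

theorem Proves.sound {Γ : Set (Formula n)} {a : Formula n} (h : Proves Γ a) :
    ∀ x : W, (∀ b ∈ Γ, Sat c x b) → Sat c x a := by
  induction h with
  | ax h => exact fun x hx => hx _ h
  | botE _ ih => exact fun x hx => (ih x hx).elim
  | andI _ _ ih₁ ih₂ => exact fun x hx => ⟨ih₁ x hx, ih₂ x hx⟩
  | andE₁ _ ih => exact fun x hx => (ih x hx).1
  | andE₂ _ ih => exact fun x hx => (ih x hx).2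
  | orI₁ _ ih => exact fun x hx => Or.inl (ih x hx)
  | orI₂ _ ih => exact fun x hx => Or.inr (ih x hx)
  | orE _ _ _ ih ih₁ ih₂ =>
    intro x hx
    rcases ih x hx with h | h
    · exact ih₁ x (Set.forall_mem_insert.2 ⟨h, hx⟩)
    · exact ih₂ x (Set.forall_mem_insert.2 ⟨h, hx⟩)
  | impI _ ih =>
    exact fun x hx y hy h => ih y (Set.forall_mem_insert.2 ⟨h, fun b hb => (hx b hb).mono hy⟩)
  | impE _ _ ih₁ ih₂ => exact fun x hx => ih₁ x hx x le_rfl (ih₂ x hx)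

theorem IsPMorphism.sat_iff {f : W → V} (hf : IsPMorphism c d f) :
    ∀ {a : Formula n} {x : W}, Sat d (f x) a ↔ Sat c x a
  | .var i, x => iff_of_eq (congrFun (hf.colour x) i)
  | .bot, _ => Iff.rfl
  | .and _ _, _ => and_congr hf.sat_iff hf.sat_iff
  | .or _ _, _ => or_congr hf.sat_iff hf.sat_iff
  | .imp a b, x => by
    constructor
    · exact fun h y hy ha => hf.sat_iff.1 (h _ (hf.monotone hy) (hf.sat_iff.2 ha))
    · intro h y hy ha
      obtain ⟨z, hz, rfl⟩ := hf.back x y hy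
      exact hf.sat_iff.2 (h z hz (hf.sat_iff.1 ha))

/-- Satisfaction in a submodel at a point all of whose successors lie in the submodel. -/
theorem sat_restrict_iff {S : Set W} : ∀ {a : Formula n} {x : S}, Set.Ici (x : W) ⊆ S →
    (Sat (c.restrict S) x a ↔ Sat c (x : W) a)
  | .var _, _, _ => Iff.rfl
  | .bot, _, _ => Iff.rfl
  | .and _ _, _, hx => and_congr (sat_restrict_iff hx) (sat_restrict_iff hx)
  | .or _ _, _, hx => or_congr (sat_restrict_iff hx) (sat_restrict_iff hx)
  | .imp a b, x, hx => by
    constructor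
    · intro h y hy ha
      have hyS : Set.Ici y ⊆ S := (Set.Ici_subset_Ici.2 hy).trans hx
      exact (sat_restrict_iff (x := ⟨y, hx hy⟩) hyS).1
        (h ⟨y, hx hy⟩ hy ((sat_restrict_iff hyS).2 ha))
    · intro h y hy ha
      have hyS : Set.Ici (y : W) ⊆ S := fun z hz => hx (le_trans (α := W) hy hz)
      exact (sat_restrict_iff hyS).2 (h y hy ((sat_restrict_iff hyS).1 ha))

/-- The set of formulas that hold at a point of a model. -/
def theory (c : Colouring n W) (x : W) : Set (Formula n) := {a | Sat c x a}

theorem IsPMorphism.theory_eq {f : W → V} (hf : IsPMorphism c d f) (x : W) :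
    theory d (f x) = theory c x :=
  Set.ext fun _ => hf.sat_iff

theorem theory_restrict {S : Set W} {x : S} (hx : Set.Ici (x : W) ⊆ S) :
    theory (c.restrict S) x = theory c (x : W) :=
  Set.ext fun _ => sat_restrict_iff hx

/-- The theory of a point is determined by its colour and the theories of its proper
successors. -/
theorem theory_eq_of_image_Ioi_eq {x y : W} (hc : c x = c y)
    (h : theory c '' Set.Ioi x = theory c '' Set.Ioi y) : theory c x = theory c y := by
  have key : ∀ {x y : W}, c x = c y → theory c '' Set.Ioi x ⊆ theory c '' Set.Ioi y →
      ∀ a b, (Sat c x a ↔ Sat c y a) → (Sat c x b ↔ Sat c y b) →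
        Sat c y (.imp a b) → Sat c x (.imp a b) := by
    intro x y _ h a b ha hb hy z hz hza
    rcases hz.eq_or_lt with rfl | hz
    · exact hb.2 (hy y le_rfl (ha.1 hza))
    · obtain ⟨z', hz', hzz⟩ := h ⟨z, hz, rfl⟩
      have e : ∀ a, Sat c z' a ↔ Sat c z a := fun a => Set.ext_iff.1 hzz a
      exact (e b).1 (hy z' (le_of_lt hz') ((e a).2 hza))
  ext a
  change Sat c x a ↔ Sat c y a
  induction a with
  | var i => exact iff_of_eq (congrFun hc i)
  | bot => exact Iff.rfl
  | and a b iha ihb => exact and_congr iha ihb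
  | or a b iha ihb => exact or_congr iha ihb
  | imp a b iha ihb =>
    exact ⟨key hc.symm h.ge a b iha.symm ihb.symm, key hc h.le a b iha ihb⟩

/-- Iterated implication replaces `⋀ l → b`: the empty list needs no `⊤`, and no connective beyond
`→` is introduced. -/
theorem sat_foldr_imp_iff {b : Formula n} : ∀ {l : List (Formula n)} {x : W},
    Sat c x (l.foldr .imp b) ↔ ∀ y, x ≤ y → (∀ a ∈ l, Sat c y a) → Sat c y b
  | [], x => ⟨fun h y hy _ => Sat.mono hy h, fun h => h x le_rfl (by simp)⟩
  | a :: l, x => by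
    simp only [List.foldr_cons, List.forall_mem_cons]
    constructor
    · exact fun h y hy ha => sat_foldr_imp_iff.1 (h y hy ha.1) y le_rfl ha.2
    · exact fun h y hy ha => sat_foldr_imp_iff.2 fun z hz hl =>
        h z (hy.trans hz) ⟨ha.mono hz, hl⟩

theorem sat_foldr_or_iff {x : W} : ∀ {l : List (Formula n)},
    Sat c x (l.foldr .or .bot) ↔ ∃ a ∈ l, Sat c x a
  | [] => by simp [Sat]
  | a :: l => by
    rw [List.exists_mem_cons_iff]
    exact or_congr Iff.rfl sat_foldr_or_iff

theorem isMeetImp_foldr_imp {b : Formula n} (hb : b.IsMeetImp) :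
    ∀ {l : List (Formula n)}, (∀ a ∈ l, a.IsMeetImp) → (l.foldr .imp b).IsMeetImp
  | [], _ => hb
  | a :: l, h => ⟨h a (by simp), isMeetImp_foldr_imp hb fun a ha => h a (by simp [ha])⟩

end Models

/-! ### Prime extensions and the truth lemma -/

section Canonical

variable {n : ℕ}

theorem Proves.weaken {Γ : Set (Formula n)} {a : Formula n} (h : Proves Γ a) :
    ∀ {Δ : Set (Formula n)}, Γ ⊆ Δ → Proves Δ a := by
  induction h with
  | ax h => exact fun hs => .ax (hs h)
  | botE _ ih => exact fun hs => .botE (ih hs)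
  | andI _ _ ih₁ ih₂ => exact fun hs => .andI (ih₁ hs) (ih₂ hs)
  | andE₁ _ ih => exact fun hs => .andE₁ (ih hs)
  | andE₂ _ ih => exact fun hs => .andE₂ (ih hs)
  | orI₁ _ ih => exact fun hs => .orI₁ (ih hs)
  | orI₂ _ ih => exact fun hs => .orI₂ (ih hs)
  | orE _ _ _ ih ih₁ ih₂ =>
    exact fun hs => .orE (ih hs) (ih₁ (Set.insert_subset_insert hs))
      (ih₂ (Set.insert_subset_insert hs))
  | impI _ ih => exact fun hs => .impI (ih (Set.insert_subset_insert hs))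
  | impE _ _ ih₁ ih₂ => exact fun hs => .impE (ih₁ hs) (ih₂ hs)

theorem Proves.cut {Γ : Set (Formula n)} {a b : Formula n} (ha : Proves Γ a)
    (hb : Proves (insert a Γ) b) : Proves Γ b :=
  .impE (.impI hb) ha

/-- Compactness, which makes Zorn's lemma applicable to the sets that do not derive a given formula.
A discharged assumption `a` is removed from the finite set and put back when the rule is applied. -/
theorem Proves.exists_finite {Γ : Set (Formula n)} {a : Formula n} (h : Proves Γ a) :
    ∃ Δ ⊆ Γ, Δ.Finite ∧ Proves Δ a := by
  have sub : ∀ {Γ Δ : Set (Formula n)} {a : Formula n}, Δ ⊆ insert a Γ → Δ \ {a} ⊆ Γ := by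
    intro Γ Δ a h
    simpa [Set.sdiff_subset_iff] using h
  have sup : ∀ {Δ E : Set (Formula n)} {a : Formula n}, Δ \ {a} ⊆ E → Δ ⊆ insert a E := by
    intro Δ E a h
    simpa [Set.sdiff_subset_iff] using h
  induction h with
  | @ax _ a h => exact ⟨{a}, by simpa using h, Set.finite_singleton _, .ax rfl⟩
  | botE _ ih => obtain ⟨Δ, hs, hf, h⟩ := ih; exact ⟨Δ, hs, hf, .botE h⟩
  | andI _ _ ih₁ ih₂ =>
    obtain ⟨Δ, hs, hf, h⟩ := ih₁
    obtain ⟨Δ', hs', hf', h'⟩ := ih₂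
    exact ⟨Δ ∪ Δ', Set.union_subset hs hs', hf.union hf',
      .andI (h.weaken Set.subset_union_left) (h'.weaken Set.subset_union_right)⟩
  | andE₁ _ ih => obtain ⟨Δ, hs, hf, h⟩ := ih; exact ⟨Δ, hs, hf, .andE₁ h⟩
  | andE₂ _ ih => obtain ⟨Δ, hs, hf, h⟩ := ih; exact ⟨Δ, hs, hf, .andE₂ h⟩
  | orI₁ _ ih => obtain ⟨Δ, hs, hf, h⟩ := ih; exact ⟨Δ, hs, hf, .orI₁ h⟩
  | orI₂ _ ih => obtain ⟨Δ, hs, hf, h⟩ := ih; exact ⟨Δ, hs, hf, .orI₂ h⟩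
  | @orE _ a b _ _ _ _ ih ih₁ ih₂ =>
    obtain ⟨Δ, hs, hf, h⟩ := ih
    obtain ⟨Δ₁, hs₁, hf₁, h₁⟩ := ih₁
    obtain ⟨Δ₂, hs₂, hf₂, h₂⟩ := ih₂
    refine ⟨Δ ∪ (Δ₁ \ {a} ∪ Δ₂ \ {b}),
      Set.union_subset hs (Set.union_subset (sub hs₁) (sub hs₂)),
      hf.union (hf₁.sdiff.union hf₂.sdiff), .orE (h.weaken Set.subset_union_left)
      (h₁.weaken (sup ?_)) (h₂.weaken (sup ?_))⟩
    · exact Set.subset_union_left.trans Set.subset_union_right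
    · exact Set.subset_union_right.trans Set.subset_union_right
  | @impI _ a _ _ ih =>
    obtain ⟨Δ, hs, hf, h⟩ := ih
    exact ⟨Δ \ {a}, sub hs, hf.sdiff, .impI (h.weaken (sup subset_rfl))⟩
  | impE _ _ ih₁ ih₂ =>
    obtain ⟨Δ, hs, hf, h⟩ := ih₁
    obtain ⟨Δ', hs', hf', h'⟩ := ih₂
    exact ⟨Δ ∪ Δ', Set.union_subset hs hs', hf.union hf',
      .impE (h.weaken Set.subset_union_left) (h'.weaken Set.subset_union_right)⟩

/-- A set of formulas that does not derive `b` extends to a point of the canonical frame that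
omits `b`. -/
theorem exists_canonPoint {Γ : Set (Formula n)} {b : Formula n} (h : ¬ Proves Γ b) :
    ∃ w : CanonPoint n, Γ ⊆ w.carrier ∧ b ∉ w.carrier := by
  obtain ⟨M, hΓM, hM⟩ := zorn_subset_nonempty {Δ : Set (Formula n) | ¬ Proves Δ b} (by
    intro C hC hchain hne
    refine ⟨⋃₀ C, fun hb => ?_, fun s hs => Set.subset_sUnion_of_mem hs⟩
    obtain ⟨Δ, hs, hf, hb⟩ := hb.exists_finite
    obtain ⟨E, hE, hΔE⟩ := hchain.directedOn.exists_mem_subset_of_finite_of_subset_sUnion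
      hne hf hs
    exact hC hE (hb.weaken hΔE)) Γ h
  have hmax : ∀ a, a ∉ M → Proves (insert a M) b := by
    intro a ha
    by_contra hb
    exact ha (hM.le_of_ge hb (Set.subset_insert a M) (Set.mem_insert a M))
  refine ⟨⟨M, ?_, ?_, ?_⟩, hΓM, fun hb => hM.prop (.ax hb)⟩
  · intro a ha
    by_contra haM
    exact hM.prop (ha.cut (hmax a haM))
  · exact fun hbot => hM.prop (.botE (.ax hbot))
  · intro a a' ha
    by_contra! hn
    exact hM.prop (.orE (.ax ha) (hmax a hn.1) (hmax a' hn.2))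

theorem CanonPoint.imp_mem_iff {w : CanonPoint n} {a b : Formula n} :
    Formula.imp a b ∈ w.carrier ↔ ∀ v, w ≤ v → a ∈ v.carrier → b ∈ v.carrier := by
  constructor
  · exact fun h v hv ha => v.closed _ (.impE (.ax (hv h)) (.ax ha))
  · intro h
    by_contra hn
    have : ¬ Proves (insert a w.carrier) b := fun hb => hn (w.closed _ (.impI hb))
    obtain ⟨v, hv, hb⟩ := exists_canonPoint this
    exact hb (h v ((Set.subset_insert _ _).trans hv) (hv (Set.mem_insert _ _)))

theorem sat_univCol_iff : ∀ {a : Formula n} {w : Univ n},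
    Sat (univCol n) w a ↔ a ∈ w.1.carrier
  | .var _, _ => Iff.rfl
  | .bot, w => ⟨fun h => h.elim, fun h => w.1.consistent h⟩
  | .and a b, w => by
    refine (and_congr sat_univCol_iff sat_univCol_iff).trans ⟨fun h => ?_, fun h => ?_⟩
    · exact w.1.closed _ (.andI (.ax h.1) (.ax h.2))
    · exact ⟨w.1.closed _ (.andE₁ (.ax h)), w.1.closed _ (.andE₂ (.ax h))⟩
  | .or a b, w => by
    refine (or_congr sat_univCol_iff sat_univCol_iff).trans ⟨fun h => ?_, w.1.prime a b⟩
    exact h.elim (fun h => w.1.closed _ (.orI₁ (.ax h))) fun h => w.1.closed _ (.orI₂ (.ax h))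
  | .imp a b, w => by
    rw [CanonPoint.imp_mem_iff]
    constructor
    · intro h v hv ha
      -- The image-finite points form an up-set of the canonical frame, so the prime extensions of
      -- `w` are all available in `U(n)`.
      let v' : Univ n := ⟨v, w.2.subset (Set.Ici_subset_Ici.2 hv)⟩
      exact (sat_univCol_iff (w := v')).1 (h v' hv (sat_univCol_iff.2 ha))
    · exact fun h v hv ha => sat_univCol_iff.2 (h v.1 hv (sat_univCol_iff.1 ha))

theorem theory_univCol (w : Univ n) : theory (univCol n) w = w.1.carrier :=
  Set.ext fun _ => sat_univCol_iff

theorem CanonPoint.mem_of_foldr_imp_mem {w : CanonPoint n} {b : Formula n} :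
    ∀ {l : List (Formula n)}, (∀ a ∈ l, a ∈ w.carrier) → l.foldr .imp b ∈ w.carrier →
      b ∈ w.carrier
  | [], _, h => h
  | a :: l, hl, h => mem_of_foldr_imp_mem (l := l) (fun a ha => hl a (by simp [ha]))
      (w.closed _ (.impE (.ax h) (.ax (hl a (by simp)))))

theorem CanonPoint.exists_mem_of_foldr_or_mem {w : CanonPoint n} :
    ∀ {l : List (Formula n)}, l.foldr .or .bot ∈ w.carrier → ∃ a ∈ l, a ∈ w.carrier
  | [], h => (w.consistent h).elim
  | a :: l, h => (w.prime _ _ h).elim (fun h => ⟨a, by simp, h⟩) fun h =>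
      let ⟨b, hb, hbw⟩ := exists_mem_of_foldr_or_mem h
      ⟨b, by simp [hb], hbw⟩

end Canonical

/-! ### The p-morphism from a model with finitely many theories to the universal model -/

section ToUniv

variable {n : ℕ} {W : Type u} {V : Type v} [PartialOrder W] [PartialOrder V]
  {c : Colouring n W} {d : Colouring n V}

/-- The theory of a point as a point of the canonical frame. -/
def theoryPoint (c : Colouring n W) (x : W) : CanonPoint n where
  carrier := theory c x
  closed _ h := h.sound x fun _ hb => hb
  consistent h := h
  prime _ _ h := h

/-- If a model has finitely many theories, then every point of the canonical frame above the
theory of `x` is the theory of a point above `x`. -/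
theorem exists_theory_eq_carrier (hfin : (Set.range (theory c)).Finite) {x : W}
    {w : CanonPoint n} (h : theory c x ⊆ w.carrier) : ∃ y, x ≤ y ∧ theory c y = w.carrier := by
  by_contra! hne
  -- Separating formulas between `w` and each theory `t`, one for each failing inclusion; `.bot` is
  -- a dummy value when the inclusion holds.
  have h₁ : ∀ t : Set (Formula n), ∃ a, ¬ w.carrier ⊆ t → a ∈ w.carrier ∧ a ∉ t := by
    intro t
    by_cases ht : w.carrier ⊆ t
    · exact ⟨.bot, fun h => (h ht).elim⟩
    · obtain ⟨a, ha⟩ := Set.not_subset.1 ht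
      exact ⟨a, fun _ => ha⟩
  have h₂ : ∀ t : Set (Formula n), ∃ a, ¬ t ⊆ w.carrier → a ∈ t ∧ a ∉ w.carrier := by
    intro t
    by_cases ht : t ⊆ w.carrier
    · exact ⟨.bot, fun h => (h ht).elim⟩
    · obtain ⟨a, ha⟩ := Set.not_subset.1 ht
      exact ⟨a, fun _ => ha⟩
  choose f hf using h₁
  choose g hg using h₂
  have fin₁ : (f '' {t ∈ Set.range (theory c) | ¬ w.carrier ⊆ t}).Finite :=
    (hfin.subset (Set.sep_subset _ _)).image f
  have fin₂ : (g '' {t ∈ Set.range (theory c) | ¬ t ⊆ w.carrier}).Finite :=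
    (hfin.subset (Set.sep_subset _ _)).image g
  let l := fin₁.toFinset.toList
  let r := fin₂.toFinset.toList
  -- Above `x`, a point satisfying all of `l` has a theory containing `w`, hence strictly larger, so
  -- it satisfies some member of `r`. Thus `⋀ l → ⋁ r` holds at `x` and belongs to `w`, although `w`
  -- contains `l` and omits all of `r`.
  have hsat : Sat c x (l.foldr .imp (r.foldr .or .bot)) := by
    refine sat_foldr_imp_iff.2 fun y hy hl => sat_foldr_or_iff.2 ?_
    have hwy : w.carrier ⊆ theory c y := by
      by_contra hn
      refine (hf _ hn).2 (hl _ ?_)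
      simp only [l, Finset.mem_toList, Set.Finite.mem_toFinset]
      exact ⟨_, ⟨⟨y, rfl⟩, hn⟩, rfl⟩
    have hyw : ¬ theory c y ⊆ w.carrier := fun hn => hne y hy (hn.antisymm hwy)
    refine ⟨g (theory c y), ?_, (hg _ hyw).1⟩
    simp only [r, Finset.mem_toList, Set.Finite.mem_toFinset]
    exact ⟨_, ⟨⟨y, rfl⟩, hyw⟩, rfl⟩
  have hl : ∀ a ∈ l, a ∈ w.carrier := by
    intro a ha
    simp only [l, Finset.mem_toList, Set.Finite.mem_toFinset] at ha
    obtain ⟨t, ht, rfl⟩ := ha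
    exact (hf t ht.2).1
  obtain ⟨a, ha, haw⟩ := CanonPoint.exists_mem_of_foldr_or_mem
    (CanonPoint.mem_of_foldr_imp_mem hl (h hsat))
  simp only [r, Finset.mem_toList, Set.Finite.mem_toFinset] at ha
  obtain ⟨t, ht, rfl⟩ := ha
  exact (hg t ht.2).2 haw

/-- The map from a model with finitely many theories to the universal model. -/
def toUniv (c : Colouring n W) (hfin : (Set.range (theory c)).Finite) (x : W) : Univ n :=
  -- Every prime filter above this one is again a theory, so only finitely many lie above.
  ⟨theoryPoint c x, (hfin.preimage (f := CanonPoint.carrier)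
    (fun _ _ _ _ h => CanonPoint.ext h)).subset fun _ hw =>
      let ⟨y, _, hy⟩ := exists_theory_eq_carrier (x := x) hfin hw
      ⟨y, hy⟩⟩

theorem isPMorphism_toUniv (hfin : (Set.range (theory c)).Finite) :
    IsPMorphism c (univCol n) (toUniv c hfin) where
  monotone _ _ h _ ha := Sat.mono h ha
  back _ _ hw :=
    let ⟨y, hy, hyw⟩ := exists_theory_eq_carrier hfin hw
    ⟨y, hy, Subtype.ext (CanonPoint.ext hyw)⟩
  colour _ := rfl

theorem toUniv_eq_iff (hfin : (Set.range (theory c)).Finite) {x : W} {w : Univ n} :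
    toUniv c hfin x = w ↔ theory c x = w.1.carrier :=
  ⟨fun h => h ▸ rfl, fun h => Subtype.ext (CanonPoint.ext h)⟩

/-! ### Models in which every point is separated -/

/-- The number of variables that fail at a point. -/
noncomputable def corank (c : Colouring n W) (x : W) : ℕ := {i | ¬ c x i}.ncard

theorem corank_lt {x y : W} (hx : x ∈ sep c) (h : x < y) : corank c y < corank c x := by
  obtain ⟨i, hi, hiy⟩ := hx
  refine Set.ncard_lt_ncard ⟨fun j hj hjx => hj (c.monotone h.le j hjx), fun hs => ?_⟩
    (Set.toFinite _)
  exact hs hi (hiy y h)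

/-- Induction on a bound for the corank: a theory is determined by the colour together with the set
of theories of proper successors. These have smaller corank, so only finitely many such pairs arise.
-/
theorem finite_range_theory (h : ∀ x, x ∈ sep c) : (Set.range (theory c)).Finite := by
  have key : ∀ k, (theory c '' {x | corank c x < k}).Finite := by
    intro k
    induction k with
    | zero => simp
    | succ k ih =>
      let f : W → (Fin n → Prop) × Set (Set (Formula n)) :=
        fun x => (c x, theory c '' Set.Ioi x)
      have hf : (theory c).FactorsThrough f := fun x y hxy =>
        theory_eq_of_image_Ioi_eq (congrArg Prod.fst hxy) (congrArg Prod.snd hxy)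
      obtain ⟨e, he⟩ := (Function.factorsThrough_iff _).1 hf
      rw [he, Set.image_comp]
      refine Set.Finite.image e ((Set.finite_univ.prod ih.powerset).subset ?_)
      rintro _ ⟨x, hx, rfl⟩
      refine ⟨trivial, Set.image_mono fun y hy => ?_⟩
      exact (corank_lt (h x) hy).trans_le (Nat.lt_succ_iff.1 hx)
  refine (key (n + 1)).subset ?_
  rintro _ ⟨x, rfl⟩
  refine ⟨x, Nat.lt_succ_iff.2 ?_, rfl⟩
  simpa [corank] using Set.ncard_le_card {i | ¬ c x i}

theorem mem_sep_restrict {S : Set W} {x : S} (hx : (x : W) ∈ sep c) :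
    x ∈ sep (c.restrict S) :=
  let ⟨i, hi, hiy⟩ := hx
  ⟨i, hi, fun y hy => hiy y hy⟩

theorem IsPMorphism.map_mem_sep {f : W → V} (hf : IsPMorphism c d f) {x : W}
    (hx : x ∈ sep c) : f x ∈ sep d := by
  obtain ⟨i, hi, hiy⟩ := hx
  refine ⟨i, by rwa [hf.colour], fun y hy => ?_⟩
  obtain ⟨z, hz, rfl⟩ := hf.back x y hy.le
  rw [hf.colour]
  exact hiy z (hz.lt_of_ne fun e => hy.ne (congrArg f e))

theorem finite_range_theory_sepModel (c : Colouring n W) :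
    (Set.range (theory c.sepModel)).Finite :=
  finite_range_theory fun x => mem_sep_restrict x.2

/-- `U(n)_{∧,→}` consists of the points all of whose successors are separated. -/
theorem mem_univMeetImp_iff {w : Univ n} :
    w ∈ univMeetImp n ↔ Set.Ici w ⊆ sep (univCol n) := by
  constructor
  · rintro ⟨f, hf, x, rfl⟩ v hv
    obtain ⟨y, -, rfl⟩ := hf.back x v hv
    exact hf.map_mem_sep (mem_sep_restrict y.2)
  · intro h
    -- The theory map fixes `w`: no successor of `w` is lost in passing to the separated points.
    refine ⟨toUniv _ (finite_range_theory_sepModel _), isPMorphism_toUniv _, ⟨w, h Set.self_mem_Ici⟩, ?_⟩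
    rw [toUniv_eq_iff, ← theory_univCol]
    exact theory_restrict h

theorem isUpperSet_univMeetImp : IsUpperSet (univMeetImp n) := fun _ _ h hw =>
  mem_univMeetImp_iff.2 ((Set.Ici_subset_Ici.2 h).trans (mem_univMeetImp_iff.1 hw))

theorem finite_univMeetImp : (univMeetImp n).Finite := by
  have hfin : (Set.range (theory ((univCol n).restrict (univMeetImp n)))).Finite :=
    finite_range_theory fun x => mem_sep_restrict (mem_univMeetImp_iff.1 x.2 Set.self_mem_Ici)
  refine (hfin.preimage (f := fun w : Univ n => w.1.carrier)
    fun _ _ _ _ h => Subtype.ext (CanonPoint.ext h)).subset fun w hw => ⟨⟨w, hw⟩, ?_⟩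
  rw [theory_restrict fun v hv => isUpperSet_univMeetImp hv hw, theory_univCol]

/-- The map to the universal model lands in `U(n)_{∧,→}` if every point is separated. -/
theorem toUniv_mem_univMeetImp (h : ∀ x, x ∈ sep c) (hfin : (Set.range (theory c)).Finite)
    (x : W) : toUniv c hfin x ∈ univMeetImp n := by
  refine mem_univMeetImp_iff.2 fun v hv => ?_
  obtain ⟨y, -, rfl⟩ := (isPMorphism_toUniv hfin).back x v hv
  exact (isPMorphism_toUniv hfin).map_mem_sep (h y)

/-- A model in which every point is separated and colours reflect the order sits in
`U(n)_{∧,→}`. -/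
theorem sitsInUnivMeetImp_of_colour_le (h : ∀ x, x ∈ sep c) (hc : ∀ x y, c x ≤ c y → x ≤ y) :
    SitsInUnivMeetImp c := by
  have hfin := finite_range_theory h
  have hf := isPMorphism_toUniv hfin
  let f : W → univMeetImp n := fun x => ⟨toUniv c hfin x, toUniv_mem_univMeetImp h hfin x⟩
  have hle : ∀ {x y}, f x ≤ f y ↔ x ≤ y := by
    refine fun {x y} => ⟨fun hxy => hc x y ?_, fun hxy => hf.monotone hxy⟩
    rw [← hf.colour, ← hf.colour]
    exact (univCol n).monotone hxy
  refine ⟨Set.range f, ?_, (OrderEmbedding.ofMapLEIff f fun _ _ => hle).orderIso, hf.colour⟩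
  rintro _ w hw ⟨x, rfl⟩
  obtain ⟨y, -, hy⟩ := hf.back x w hw
  exact ⟨y, Subtype.ext hy⟩

/-! ### Definability in `U(n)_{∧,→}` -/

/-- The complement of a principal down-set of `U(n)_{∧,→}` is defined by a `(∧,→)`-formula. -/
theorem exists_isMeetImp_sat_iff_not_le {u : Univ n} (hu : u ∈ univMeetImp n) :
    ∃ β : Formula n, β.IsMeetImp ∧ ∀ v ∈ univMeetImp n, Sat (univCol n) v β ↔ ¬ v ≤ u := by
  induction hk : corank (univCol n) u using Nat.strong_induction_on generalizing u with
  | _ k ih =>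
  subst hk
  have ih' : ∀ v : Univ n, ∃ β : Formula n, v ∈ univMeetImp n →
      corank (univCol n) v < corank (univCol n) u →
      β.IsMeetImp ∧ ∀ x ∈ univMeetImp n, Sat (univCol n) x β ↔ ¬ x ≤ v := by
    intro v
    by_cases hv : v ∈ univMeetImp n ∧ corank (univCol n) v < corank (univCol n) u
    · obtain ⟨β, hβ⟩ := ih _ hv.2 hv.1 rfl
      exact ⟨β, fun _ _ => hβ⟩
    · exact ⟨.bot, fun h₁ h₂ => (hv ⟨h₁, h₂⟩).elim⟩
  choose β hβ using ih'
  have hsep : ∀ v ∈ univMeetImp n, v ∈ sep (univCol n) := fun v hv =>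
    mem_univMeetImp_iff.1 hv Set.self_mem_Ici
  -- The formula for `u` will be `⋀ G → p_k`, where `G` pins down `u` among the points refuting
  -- `p_k` by its colour and its proper successors.
  obtain ⟨k, hk, hku⟩ := hsep u hu
  let above : Set (Univ n) := {v ∈ univMeetImp n | u < v}
  let other : Set (Univ n) :=
    {v ∈ univMeetImp n | corank (univCol n) v < corank (univCol n) u ∧ ¬ u < v}
  have habove : ∀ v, u < v → v ∈ above := fun v hv => ⟨isUpperSet_univMeetImp hv.le hu, hv⟩
  have hβa : ∀ v ∈ above, (β v).IsMeetImp ∧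
      ∀ x ∈ univMeetImp n, Sat (univCol n) x (β v) ↔ ¬ x ≤ v :=
    fun v hv => hβ v hv.1 (corank_lt (hsep u hu) hv.2)
  have hβo : ∀ v ∈ other, (β v).IsMeetImp ∧
      ∀ x ∈ univMeetImp n, Sat (univCol n) x (β v) ↔ ¬ x ≤ v :=
    fun v hv => hβ v hv.1 hv.2.1
  let G : Set (Formula n) := Formula.var '' {j | univCol n u j} ∪
    (fun j => Formula.imp (.var j) (.var k)) '' {j | ¬ univCol n u j} ∪
    (fun v => Formula.imp (β v) (.var k)) '' above ∪
    (fun v => Formula.imp (.var k) (β v)) '' other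
  have hG : G.Finite :=
    (((Set.toFinite _).union (Set.toFinite _)).union
      ((finite_univMeetImp.subset (Set.sep_subset _ _)).image _)).union
      ((finite_univMeetImp.subset (Set.sep_subset _ _)).image _)
  have hGmem : ∀ {P : Formula n → Prop}, (∀ a ∈ hG.toFinset.toList, P a) ↔
      (((∀ j, univCol n u j → P (.var j)) ∧
        ∀ j, ¬ univCol n u j → P (.imp (.var j) (.var k))) ∧
        ∀ v ∈ above, P (.imp (β v) (.var k))) ∧ ∀ v ∈ other, P (.imp (.var k) (β v)) := by
    intro P
    simp only [Finset.mem_toList, Set.Finite.mem_toFinset, G, Set.mem_union, or_imp,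
      forall_and, Set.forall_mem_image, Set.mem_ofPred_eq]
  refine ⟨hG.toFinset.toList.foldr .imp (.var k), isMeetImp_foldr_imp (b := .var k) trivial (hGmem.2
    ⟨⟨⟨fun _ _ => trivial, fun _ _ => ⟨trivial, trivial⟩⟩, fun v hv => ⟨(hβa v hv).1, trivial⟩⟩,
      fun v hv => ⟨trivial, (hβo v hv).1⟩⟩), fun v hv => ?_⟩
  rw [sat_foldr_imp_iff]
  constructor
  · intro h hvu
    refine hk (h u hvu (hGmem.2 ⟨⟨⟨fun _ hj => hj, ?_⟩, ?_⟩, ?_⟩))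
    · intro j hj x hx hxj
      rcases hx.eq_or_lt with rfl | hx
      · exact (hj hxj).elim
      · exact hku x hx
    · intro v hv x hx hxv
      rcases hx.eq_or_lt with rfl | hx
      · exact (((hβa v hv).2 u hu).1 hxv hv.2.le).elim
      · exact hku x hx
    · intro v hv x hx hxk
      refine ((hβo v hv).2 x (isUpperSet_univMeetImp hx hu)).2 fun hxv => hv.2.2 ?_
      rcases hx.eq_or_lt with rfl | hx
      · exact (hk hxk).elim
      · exact hx.trans_le hxv
  -- A point `x ≥ v` satisfying `G` but not `p_k` has the colour and the proper successors of `u`,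
  -- so `x = u`, contradicting `¬ v ≤ u`.
  · intro hvu x hvx hx
    obtain ⟨⟨⟨hpos, hneg⟩, hab⟩, hot⟩ := hGmem.1 hx
    by_contra hxk
    have hxK := isUpperSet_univMeetImp hvx hv
    have colour_eq : ∀ y, x ≤ y → ¬ univCol n y k → univCol n u = univCol n y := by
      refine fun y hy hyk => funext fun j => propext ⟨fun hj => (hpos j hj).mono hy, fun hj => ?_⟩
      by_contra hju
      exact hyk (hneg j hju y hy hj)
    have hxu := colour_eq x le_rfl hxk
    have hrank : corank (univCol n) u = corank (univCol n) x := by simp only [corank, hxu]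
    have hIoi : Set.Ioi x = Set.Ioi u := by
      ext y
      constructor
      · intro hy
        have hyK := isUpperSet_univMeetImp (le_of_lt hy) hxK
        have hlt : corank (univCol n) y < corank (univCol n) u :=
          hrank ▸ corank_lt (hsep x hxK) hy
        -- Otherwise `y` would have the colour of `u`, against its smaller corank.
        have hyk : univCol n y k := by
          by_contra hyk
          refine hlt.ne ?_
          simp only [corank, colour_eq y (le_of_lt hy) hyk]
        by_contra hyu
        exact ((hβo y ⟨hyK, hlt, hyu⟩).2 y hyK).1 (hot y ⟨hyK, hlt, hyu⟩ y (le_of_lt hy) hyk)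
          le_rfl
      · intro hy
        have hxy : x ≤ y := by
          by_contra hxy
          exact hxk (hab y (habove y hy) x le_rfl (((hβa y (habove y hy)).2 x hxK).2 hxy))
        refine hxy.lt_of_ne fun e => ?_
        exact (corank_lt (hsep u hu) hy).ne (e ▸ hrank.symm)
    have : theory (univCol n) x = theory (univCol n) u :=
      theory_eq_of_image_Ioi_eq hxu.symm (by rw [hIoi])
    rw [theory_univCol, theory_univCol] at this
    exact hvu (hvx.trans_eq (Subtype.ext (CanonPoint.ext this)))

/-! ### `(∧,→)`-formulas in the submodel of separated points -/

/-- A maximal point refuting a `(∧,→)`-formula is separated. -/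
theorem mem_sep_of_maximal : ∀ {a : Formula n}, a.IsMeetImp → ∀ {x : W}, ¬ Sat c x a →
    (∀ y, x < y → Sat c y a) → x ∈ sep c
  | .var i, _, _, hx, hmax => ⟨i, hx, hmax⟩
  | .and a b, h, x, hx, hmax => by
    rcases not_and_or.1 hx with hx | hx
    · exact mem_sep_of_maximal h.1 hx fun y hy => (hmax y hy).1
    · exact mem_sep_of_maximal h.2 hx fun y hy => (hmax y hy).2
  | .imp a b, h, x, hx, hmax => by
    -- By maximality the implication can fail only at `x` itself, and then `x` is also maximal
    -- refuting `b`.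
    have hab : Sat c x a ∧ ¬ Sat c x b := by
      by_contra hn
      refine hx fun y hy hya => ?_
      rcases hy.eq_or_lt with rfl | hy
      · exact not_not.1 fun hb => hn ⟨hya, hb⟩
      · exact hmax y hy y le_rfl hya
    exact mem_sep_of_maximal h.2 hab.2 fun y hy => hmax y hy y le_rfl (hab.1.mono hy.le)

/-- A counterexample to `a → b` can be moved up to a maximal point refuting `b`, where `a` persists
and which is separated. For `⊥` or `∨` such a point need not be separated. -/
theorem sat_sepModel_iff
    (hmax : ∀ (a : Formula n) (x : W), ¬ Sat c x a →
      ∃ y, x ≤ y ∧ ¬ Sat c y a ∧ ∀ z, y < z → Sat c z a) :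
    ∀ {a : Formula n}, a.IsMeetImp → ∀ {x : sep c}, Sat c.sepModel x a ↔ Sat c (x : W) a
  | .var _, _, _ => Iff.rfl
  | .and _ _, h, _ => and_congr (sat_sepModel_iff hmax h.1) (sat_sepModel_iff hmax h.2)
  | .imp a b, h, x => by
    constructor
    · intro hx y hy ha
      by_contra hb
      obtain ⟨z, hyz, hz, hzmax⟩ := hmax b y hb
      let z' : sep c := ⟨z, mem_sep_of_maximal h.2 hz hzmax⟩
      exact hz ((sat_sepModel_iff hmax h.2 (x := z')).1 (hx z' (hy.trans hyz)
        ((sat_sepModel_iff hmax h.1).2 (ha.mono hyz))))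
    · exact fun hx y hy ha => (sat_sepModel_iff hmax h.2).2
        (hx y hy ((sat_sepModel_iff hmax h.1).1 ha))

theorem refutes_sepModel_iff
    (hmax : ∀ (a : Formula n) (x : W), ¬ Sat c x a →
      ∃ y, x ≤ y ∧ ¬ Sat c y a ∧ ∀ z, y < z → Sat c z a) {a : Formula n} (h : a.IsMeetImp) :
    Refutes c.sepModel a ↔ Refutes c a := by
  constructor
  · exact fun ⟨x, hx⟩ => ⟨x, fun hs => hx ((sat_sepModel_iff hmax h).2 hs)⟩
  · rintro ⟨x, hx⟩
    obtain ⟨y, -, hy, hymax⟩ := hmax a x hx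
    exact ⟨⟨y, mem_sep_of_maximal h hy hymax⟩, fun hs => hy ((sat_sepModel_iff hmax h).1 hs)⟩

theorem GeneralFrame.IsAdmissible.setOf_sat_mem {A : GeneralFrame W} (hc : A.IsAdmissible c) :
    ∀ a : Formula n, {x | Sat c x a} ∈ A.adm
  | .var i => hc i
  | .bot => A.empty_mem
  | .and a b => A.inter_mem _ (setOf_sat_mem hc a) _ (setOf_sat_mem hc b)
  | .or a b => A.union_mem _ (setOf_sat_mem hc a) _ (setOf_sat_mem hc b)
  | .imp a b => A.imp_mem _ (setOf_sat_mem hc a) _ (setOf_sat_mem hc b)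

/-- In a descriptive frame, every point outside an admissible set lies below a maximal one. -/
theorem GeneralFrame.IsDescriptive.exists_maximal_notMem {A : GeneralFrame W}
    (hA : A.IsDescriptive) {U : Set W} (hU : U ∈ A.adm) {x : W} (hx : x ∉ U) :
    ∃ y, x ≤ y ∧ y ∉ U ∧ ∀ z, y < z → z ∈ U := by
  obtain ⟨m, hxm, hm⟩ := zorn_le_nonempty₀ Uᶜ (by
    intro C hC hchain y hy
    have common : ∀ a ∈ C, ∀ b ∈ C, ∃ d ∈ C, a ≤ d ∧ b ≤ d := hchain.directedOn
    -- The union of the prime filters of the points of the chain is a prime filter; its point bounds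
    -- the chain and avoids `U`.
    obtain ⟨z, hz⟩ := hA.exists_point {V | V ∈ A.adm ∧ ∃ a ∈ C, a ∈ V} {
      subset_adm := fun V hV => hV.1
      univ_mem := ⟨A.univ_mem, y, hy, trivial⟩
      empty_notMem := fun h => let ⟨_, _, _, h⟩ := h; h
      inter_mem := by
        rintro V ⟨hV, a, ha, haV⟩ V' ⟨hV', b, hb, hbV⟩
        obtain ⟨e, he, hae, hbe⟩ := common a ha b hb
        exact ⟨A.inter_mem _ hV _ hV', e, he, A.isUpperSet _ hV hae haV,
          A.isUpperSet _ hV' hbe hbV⟩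
      upward := fun V ⟨_, a, ha, haV⟩ V' hV' hs => ⟨hV', a, ha, hs haV⟩
      prime := fun V hV V' hV' ⟨_, a, ha, haV⟩ =>
        haV.imp (fun h => ⟨hV, a, ha, h⟩) fun h => ⟨hV', a, ha, h⟩ }
    refine ⟨z, fun hzU => ?_, fun a ha => hA.le_of_forall a z fun V hV haV => ?_⟩
    · have : U ∈ {V | V ∈ A.adm ∧ ∃ a ∈ C, a ∈ V} := hz ▸ ⟨hU, hzU⟩
      obtain ⟨-, a, ha, haU⟩ := this
      exact hC ha haU
    · have : V ∈ {V | V ∈ A.adm ∧ z ∈ V} := hz ▸ ⟨hV, a, ha, haV⟩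
      exact this.2) x hx
  refine ⟨m, hxm, hm.prop, fun z hz => ?_⟩
  by_contra hzU
  exact hz.not_ge (hm.le_of_ge hzU hz.le)

theorem IsPMorphism.comp {X : Type*} [PartialOrder X] {e : Colouring n X} {g : V → X}
    {f : W → V} (hg : IsPMorphism d e g) (hf : IsPMorphism c d f) :
    IsPMorphism c e (g ∘ f) where
  monotone := hg.monotone.comp hf.monotone
  back x y hy := by
    obtain ⟨v, hv, rfl⟩ := hg.back _ y hy
    obtain ⟨x', hx', rfl⟩ := hf.back _ v hv
    exact ⟨x', hx', rfl⟩
  colour x := (hg.colour _).trans (hf.colour x)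

/-- A rooted model that embeds as a generated submodel of the universal model is a p-morphic
image of a generated submodel of a model with finitely many theories iff the theory of its root
is realized there. -/
theorem exists_isPMorphicImage_iff (hfin : (Set.range (theory c)).Finite) {f : V → Univ n}
    (hf : IsPMorphism d (univCol n) f) (hinj : ∀ x y, f x ≤ f y → x ≤ y) {r : V}
    (hr : ∀ x, r ≤ x) :
    (∃ S : Set W, IsUpperSet S ∧ IsPMorphicImage d (c.restrict S)) ↔
      ∃ x, toUniv c hfin x = f r := by
  constructor
  · rintro ⟨S, hS, g, hg, hsurj⟩
    obtain ⟨x, hx⟩ := hsurj r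
    refine ⟨x, ?_⟩
    rw [toUniv_eq_iff, ← theory_univCol, hf.theory_eq, ← hx, hg.theory_eq,
      theory_restrict fun y hy => hS hy x.2]
  · rintro ⟨x, hx⟩
    have ht := isPMorphism_toUniv hfin
    -- On the preimage of the up-set of `f r`, the theory map factors through the embedding `f`; the
    -- factor is the required p-morphism.
    have hS : ∀ y : toUniv c hfin ⁻¹' Set.Ici (f r), ∃ v, f v = toUniv c hfin y := fun y =>
      let ⟨v, _, hv⟩ := hf.back r _ y.2
      ⟨v, hv⟩
    choose g hg using hS
    refine ⟨toUniv c hfin ⁻¹' Set.Ici (f r), fun y z hyz hy => le_trans hy (ht.monotone hyz), g,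
      ⟨fun y z hyz => hinj _ _ ?_, fun y v hv => ?_, fun y => ?_⟩, fun v => ?_⟩
    · rw [hg, hg]
      exact ht.monotone hyz
    · obtain ⟨z, hyz, hz⟩ := ht.back y (f v) (hg y ▸ hf.monotone hv)
      refine ⟨⟨z, ?_⟩, hyz, le_antisymm (hinj _ _ ?_) (hinj _ _ ?_)⟩
      · exact le_trans y.2 (ht.monotone hyz)
      · rw [hg]; exact hz.le
      · rw [hg]; exact hz.ge
    · rw [← hf.colour, hg, ht.colour]
      rfl
    · obtain ⟨z, hxz, hz⟩ := ht.back x (f v) (hx ▸ hf.monotone (hr v))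
      have hzS : z ∈ toUniv c hfin ⁻¹' Set.Ici (f r) := hx ▸ ht.monotone hxz
      refine ⟨⟨z, hzS⟩, le_antisymm (hinj _ _ ?_) (hinj _ _ ?_)⟩
      · rw [hg]; exact hz.le
      · rw [hg]; exact hz.ge

theorem SitsInUnivMeetImp.exists_isPMorphism (h : SitsInUnivMeetImp c) :
    ∃ f : W → Univ n, IsPMorphism c (univCol n) f ∧ (∀ x y, f x ≤ f y → x ≤ y) ∧
      ∀ x, f x ∈ univMeetImp n := by
  obtain ⟨S, hS, g, hg⟩ := h
  refine ⟨fun x => (g x).1.1, ⟨fun x y hxy => g.monotone hxy, fun x y hy => ?_, hg⟩,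
    fun x y hxy => g.le_iff_le.1 hxy, fun x => (g x).1.2⟩
  have hyK := isUpperSet_univMeetImp hy (g x).1.2
  have hyS : (⟨y, hyK⟩ : univMeetImp n) ∈ S := hS hy (g x).2
  obtain ⟨x', hx'⟩ := g.surjective ⟨_, hyS⟩
  refine ⟨x', g.le_iff_le.1 ?_, by rw [hx']⟩
  rw [hx']
  exact hy

end ToUniv

end MeetImp

theorem theorem4p2 {F : Type u} [PartialOrder F] [Finite F] (hF : ∃ r : F, ∀ x, r ≤ x) :
    (∀ (n : ℕ) (e : Fin n ≃ F), MeetImp.SitsInUnivMeetImp (MeetImp.enumCol e)) ∧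
    ∀ (n : ℕ) (c : MeetImp.Colouring n F), MeetImp.SitsInUnivMeetImp c →
      ∃ β : MeetImp.Formula n, β.IsMeetImp ∧
        ∀ (N : Type v) [PartialOrder N] (A : MeetImp.GeneralFrame N) (d : MeetImp.Colouring n N),
          A.IsDescriptive → A.IsAdmissible d →
          (MeetImp.Refutes d β ↔
            ∃ S : Set (MeetImp.sep d), IsUpperSet S ∧
              MeetImp.IsPMorphicImage c (d.sepModel.restrict S)) := by
  open MeetImp in
  obtain ⟨r, hr⟩ := hF
  refine ⟨fun n e => sitsInUnivMeetImp_of_colour_le (fun x => ?_) fun x y h => ?_,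
    fun n c hc => ?_⟩
  -- The variable indexed by `x` fails exactly on the down-set of `x`, so `x` is its border point.
  · refine ⟨e.symm x, fun h => h (by simp), fun y hy h => hy.not_ge ?_⟩
    simpa using h
  · by_contra hxy
    exact h (e.symm y) (fun hx => hxy (by simpa using hx)) (by simp)
  · obtain ⟨f, hf, hinj, hfK⟩ := hc.exists_isPMorphism
    obtain ⟨β, hβ, hsat⟩ := exists_isMeetImp_sat_iff_not_le (hfK r)
    refine ⟨β, hβ, fun N _ A d hA hd => ?_⟩
    have hfin := finite_range_theory_sepModel d
    have ht := isPMorphism_toUniv hfin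
    rw [exists_isPMorphicImage_iff hfin hf hinj hr, ← refutes_sepModel_iff
      (fun a x hx => hA.exists_maximal_notMem (hd.setOf_sat_mem a) hx) hβ]
    -- Refutation of `β` only yields an image below `f r`; the back condition then supplies a point
    -- mapped onto `f r`.
    have hiff : ∀ x, ¬ Sat d.sepModel x β ↔ toUniv _ hfin x ≤ f r := fun x => by
      have hx := hsat (toUniv _ hfin x)
        (toUniv_mem_univMeetImp (fun x => mem_sep_restrict x.2) hfin x)
      rw [← ht.sat_iff, hx, not_not]
    constructor
    · rintro ⟨x, hx⟩
      obtain ⟨y, -, hy⟩ := ht.back x _ ((hiff x).1 hx)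
      exact ⟨y, hy⟩
    · exact fun ⟨x, hx⟩ => ⟨x, (hiff x).2 hx.le⟩
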